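/- **Setting.** Let $X$ be an infinite dimensional separable real Banach space with a zero mean Gaussian (Borel probability) measure $\mu$, let $\mathrm{Im}:X\to H=L_2([0,1])$ be an injective continuous linear map, let $\nu=\mu\,\mathrm{Im}^{-1}$, and let $C_\nu:H\to H$ be its covariance operator, $\langle C_\nu h_1,h_2\rangle_H=\int_H\langle h,h_1\rangle_H\langle h,h_2\rangle_H\,\nu(dh)$. Let $(\eta_i)_{i\ge1}$ be an orthonormal sequence in $H$ with $C_\nu\eta_i=\lambda_i\eta_i$, where all eigenvalues $\lambda_i$ are positive. For an integer $r\ge1$ and positive numbers $K_0,\dots,K_r$, let $F_r$ be the class of functions $f:X\to\mathbb R$ that are $r-1$ times Fréchet differentiable, with $\sup_{x\in X}\|f^{(i)}(x)\|\le K_i$ for $0\le i\le r-1$ and $\|f^{(r-1)}(x)-f^{(r-1)}(y)\|\le K_r\|\mathrm{Im}(x-y)\|_H$ for all $x,y\in X$. Path integration is the problem of approximating $I(f)=\int_X f(x)\,\mu(dx)$ for $f\in F_r$. **Quantum algorithms.** A quantum query is given by integers $m',m'',m'''\ge0$, a set $Z\subseteq\{0,\dots,2^{m'}-1\}$ and maps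 $\tau:Z\to X$ and $\beta:\mathbb R\to\{0,\dots,2^{m''}-1\}$; for $f:X\to\mathbb R$ it is the unitary operator $Q_f$ on $m'+m''+m'''$ qubits with $Q_f|i\rangle|x\rangle|y\rangle=|i\rangle|x\oplus\beta(f(\tau(i)))\rangle|y\rangle$ if $i\in Z$, and $Q_f|i\rangle|x\rangle|y\rangle=|i\rangle|x\rangle|y\rangle$ otherwise, where $\oplus$ is addition modulo $2^{m''}$. A quantum algorithm consists of finitely many stages. The $\ell$th stage starts in a computational basis state that is a function of the measurement outcomes of the earlier stages, applies $U_{n_\ell}Q_fU_{n_\ell-1}Q_f\cdots U_1Q_fU_0$ with a query $Q$ and unitary operators $U_j$ that do not depend on $f$ (but may depend on $\ell$), and ends with a measurement in the computational basis. The output is a real function of all measurement outcomes, and the number of quantum queries is $\sum_\ell n_\ell$. Let $\mathrm{qq}(\varepsilon,F_r)$ be the minimal number of quantum queries of a quantum algorithm which, for every $f\in F_r$, outputs a number within $\varepsilon$ of $I(f)$ with probability at least $3/4$ ($\infty$ if there is none). **Theorem.** For every $\alpha\in(0,1)$, $$\lim_{\varepsilon\to0^+}\ \varepsilon^{1-\alpha}\,\mathrm{qq}(\varepsilon,F_r)=\infty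 .$$ -/

import Mathlib

open MeasureTheory ProbabilityTheory Filter Topology
open scoped ENNReal

namespace PathInt

noncomputable section

/-! ### The quantum query model for real-valued functions `f : D → ℝ` -/

/-- A quantum query. The computational basis consists of the states `|i⟩|x⟩|y⟩` with
`0 ≤ i < 2 ^ idxQubits`, `0 ≤ x < 2 ^ valQubits` and `0 ≤ y < 2 ^ workQubits`.
`node` assigns to an index `i` the point of `D` at which the function is evaluated
(`none` if the query does nothing for that index), and `code` turns a real function value
into a `valQubits`-bit number. -/
structure QuantumQuery (D : Type*) where
  idxQubits : ℕ
  valQubits : ℕ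
  workQubits : ℕ
  node : Fin (2 ^ idxQubits) → Option D
  code : ℝ → Fin (2 ^ valQubits)

namespace QuantumQuery

variable {D : Type*}

/-- The computational basis: it has `2 ^ (idxQubits + valQubits + workQubits)` elements. -/
abbrev BasisState (Q : QuantumQuery D) : Type :=
  Fin (2 ^ Q.idxQubits) × Fin (2 ^ Q.valQubits) × Fin (2 ^ Q.workQubits)

/-- `|i⟩|x⟩|y⟩ ↦ |i⟩|x ⊕ code (f (node i))⟩|y⟩`, where `⊕` is addition modulo
`2 ^ valQubits`; basis states whose index has no node are fixed. -/
def act (Q : QuantumQuery D) (f : D → ℝ) (s : Q.BasisState) : Q.BasisState :=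
  match Q.node s.1 with
  | none => s
  | some t => (s.1, s.2.1 + Q.code (f t), s.2.2)

/-- The matrix of the query operator `Q_f`, whose column `s` is the basis state `act f s`. -/
def matrix (Q : QuantumQuery D) (f : D → ℝ) : Matrix Q.BasisState Q.BasisState ℂ :=
  Matrix.of fun s t => if s = Q.act f t then 1 else 0

end QuantumQuery

/-- A quantum algorithm without measurement: a query `Q`, a number `n` of query calls, and
unitary operations `U 0, …, U n` independent of `f` (the values of `U` beyond `n` are not
used). -/
structure UnitaryStage (D : Type*) where
  Q : QuantumQuery D
  n : ℕ
  U : ℕ → Matrix.unitaryGroup Q.BasisState ℂ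

namespace UnitaryStage

variable {D : Type*}

/-- `U j * Q_f * U (j - 1) * ⋯ * U 1 * Q_f * U 0`. -/
def evolve (A : UnitaryStage D) (f : D → ℝ) : ℕ → Matrix A.Q.BasisState A.Q.BasisState ℂ
  | 0 => (A.U 0 : Matrix A.Q.BasisState A.Q.BasisState ℂ)
  | j + 1 => (A.U (j + 1) : Matrix A.Q.BasisState A.Q.BasisState ℂ) * A.Q.matrix f * A.evolve f j

/-- The probability of measuring the basis state `out` after running the stage on input `f`
from the basis state `inp`. -/
def prob (A : UnitaryStage D) (f : D → ℝ) (inp out : A.Q.BasisState) : ℝ :=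
  ‖A.evolve f A.n out inp‖ ^ 2

end UnitaryStage

/-- A quantum algorithm with finitely many measurements and a real output. The stages are run
one after the other; each of them starts in a basis state computed classically (by `start`)
from the outcomes of the measurements of all the earlier stages, and ends with a measurement
in the computational basis. The output is a function of all the measurement outcomes. -/
structure QuantumAlgorithm (D : Type*) where
  numStages : ℕ
  stage : Fin numStages → UnitaryStage D
  start : (l : Fin numStages) → ((j : Fin numStages) → j < l → (stage j).Q.BasisState) →
    (stage l).Q.BasisState
  output : ((l : Fin numStages) → (stage l).Q.BasisState) → ℝ

namespace QuantumAlgorithm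

variable {D : Type*}

/-- All the sequences of measurement outcomes. -/
abbrev Outcome (A : QuantumAlgorithm D) : Type :=
  (l : Fin A.numStages) → (A.stage l).Q.BasisState

/-- The total number of quantum queries. -/
def queries (A : QuantumAlgorithm D) : ℕ := ∑ l, (A.stage l).n

/-- The probability that the sequence of measurement outcomes is `ξ`, on input `f`. -/
def outcomeProb (A : QuantumAlgorithm D) (f : D → ℝ) (ξ : A.Outcome) : ℝ :=
  ∏ l, (A.stage l).prob f (A.start l fun j _ => ξ j) (ξ l)

open Classical in
/-- The probability that the output of `A` on input `f` lies in `S`. -/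
def outputProb (A : QuantumAlgorithm D) (f : D → ℝ) (S : Set ℝ) : ℝ :=
  ∑ ξ : A.Outcome, if A.output ξ ∈ S then A.outcomeProb f ξ else 0

/-- `A` computes an `ε`-approximation of `I f` with probability at least `3 / 4`,
for every `f ∈ F`. -/
def Approximates (A : QuantumAlgorithm D) (I : (D → ℝ) → ℝ) (F : Set (D → ℝ)) (ε : ℝ) : Prop :=
  ∀ f ∈ F, 3 / 4 ≤ A.outputProb f {a | |I f - a| ≤ ε}

end QuantumAlgorithm

/-- The minimal number of quantum queries of a quantum algorithm that computes an
`ε`-approximation of `I f` with probability at least `3 / 4` for all `f ∈ F`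
(`⊤` if there is no such algorithm). -/
def qq {D : Type*} (I : (D → ℝ) → ℝ) (F : Set (D → ℝ)) (ε : ℝ) : ℕ∞ :=
  ⨅ (A : QuantumAlgorithm D) (_ : A.Approximates I F ε), (A.queries : ℕ∞)

/-! ### Path integration -/

/-- The real Hilbert space `L₂([0,1])`. -/
abbrev L2I : Type := Lp ℝ 2 (volume : Measure unitInterval)

instance : MeasurableSpace L2I := borel L2I

instance : BorelSpace L2I := ⟨rfl⟩

section

variable {X : Type*} [NormedAddCommGroup X] [NormedSpace ℝ X]

/-- The class `F_r` (for `r ≥ 1`): functions on `X` that are `r - 1` times Fréchet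
differentiable, with the derivatives of order `i ≤ r - 1` bounded by `K i`, and such that the
derivative of order `r - 1` is Lipschitz with constant `K r` with respect to the norm of
`L₂([0,1])` (so that this derivative is continuous). -/
def classF (Im : X →L[ℝ] L2I) (r : ℕ) (K : ℕ → ℝ) : Set (X → ℝ) :=
  {f | ContDiff ℝ ((r - 1 : ℕ) : ℕ∞) f ∧
    (∀ i < r, ∀ x, ‖iteratedFDeriv ℝ i f x‖ ≤ K i) ∧
    ∀ x y, ‖iteratedFDeriv ℝ (r - 1) f x - iteratedFDeriv ℝ (r - 1) f y‖ ≤ K r * ‖Im (x - y)‖}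

/-- The path integral. -/
def pathIntegral [MeasurableSpace X] (μ : Measure X) (f : X → ℝ) : ℝ := ∫ x, f x ∂μ

end

end

end PathInt

/-!
Place `n ^ d` bumps on a lattice in the span of `d` of the eigenvectors of the covariance operator
and pull them back to the path space. Multiplied by a constant times `n ^ (-r)` their combinations
with coefficients in `[-1, 1]` lie in the class `F_r`, and because the law of the first `d`
coordinates has a positive density each scaled bump has integral at least of order
`n ^ (-(r + d))`. An algorithm with an error below this order therefore counts, and in particular
computes the parity of, `n ^ d` bits, each value of the input function depending on a single bit.
Its output probabilities have degree at most twice the number of queries in the bits, whereas parity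
is orthogonal to all functions of degree less than `n ^ d`. So the number of queries is at least
`n ^ d / 2`, which is of order `ε ^ (-d / (r + d))`, and the exponent tends to `-1` as `d → ∞`.
-/

namespace PathInt

section BooleanDegree

variable {ι : Type*}

/-- A `k`-junta: a function of a family of variables that depends on at most `k` of them. -/
def IsJunta {α : ι → Type*} {β : Type*} (k : ℕ) (g : (∀ i, α i) → β) : Prop :=
  ∃ s : Finset ι, s.card ≤ k ∧ DependsOn g s

section

variable {α : ι → Type*} {β γ δ : Type*} {k l : ℕ}

lemma isJunta_const (k : ℕ) (c : β) : IsJunta k fun _ : ∀ i, α i => c :=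
  ⟨∅, by simp, by simpa using dependsOn_const c⟩

lemma IsJunta.comp {g : (∀ i, α i) → β} (hg : IsJunta k g) (φ : β → γ) :
    IsJunta k fun b => φ (g b) := by
  obtain ⟨s, hs, hgs⟩ := hg
  exact ⟨s, hs, fun _ _ hxy => congrArg φ (hgs hxy)⟩

lemma IsJunta.comp₂ {g : (∀ i, α i) → β} {h : (∀ i, α i) → γ} (hg : IsJunta k g)
    (hh : IsJunta l h) (φ : β → γ → δ) : IsJunta (k + l) fun b => φ (g b) (h b) := by
  classical
  obtain ⟨s, hs, hgs⟩ := hg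
  obtain ⟨t, ht, hht⟩ := hh
  exact ⟨s ∪ t, (Finset.card_union_le s t).trans (add_le_add hs ht), fun x y hxy =>
    congrArg₂ φ (hgs fun i hi => hxy i (Finset.mem_union_left t hi))
      (hht fun i hi => hxy i (Finset.mem_union_right s hi))⟩

end

/-- The `R`-valued functions of the bits `b i`, `i : ι`, of degree at most `k`. They are encoded as
the span of the `k`-juntas, which contains exactly the multilinear polynomials of degree at most
`k` in the bits. -/
def degreeLE (R ι : Type*) [CommSemiring R] (k : ℕ) : Submodule R ((ι → Bool) → R) :=
  Submodule.span R {g | IsJunta k g}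

section

variable {R S : Type*} [CommSemiring R] [CommSemiring S] {k l : ℕ}

lemma IsJunta.mem_degreeLE {g : (ι → Bool) → R} (hg : IsJunta k g) : g ∈ degreeLE R ι k :=
  Submodule.subset_span hg

lemma const_mem_degreeLE (k : ℕ) (c : R) : (fun _ => c) ∈ degreeLE R ι k :=
  (isJunta_const k c).mem_degreeLE

lemma mul_mem_degreeLE {g h : (ι → Bool) → R} (hg : g ∈ degreeLE R ι k)
    (hh : h ∈ degreeLE R ι l) : g * h ∈ degreeLE R ι (k + l) := by
  have hgh := Submodule.mul_mem_mul hg hh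
  rw [degreeLE, degreeLE, Submodule.span_mul_span] at hgh
  refine Submodule.span_mono ?_ hgh
  rintro _ ⟨g, hg, h, hh, rfl⟩
  exact hg.comp₂ hh (· * ·)

lemma prod_mem_degreeLE {κ : Type*} (s : Finset κ) (k : κ → ℕ) (g : κ → (ι → Bool) → R)
    (hg : ∀ i ∈ s, g i ∈ degreeLE R ι (k i)) :
    ∏ i ∈ s, g i ∈ degreeLE R ι (∑ i ∈ s, k i) := by
  classical
  induction s using Finset.induction_on with
  | empty => exact const_mem_degreeLE 0 1
  | insert a s ha ih =>
    rw [Finset.prod_insert ha, Finset.sum_insert ha]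
    exact mul_mem_degreeLE (hg a (by simp)) (ih fun i hi => hg i (by simp [hi]))

lemma comp_mem_degreeLE {g : (ι → Bool) → R} (hg : g ∈ degreeLE R ι k) (φ : R →+ S) :
    (fun b => φ (g b)) ∈ degreeLE S ι k := by
  induction hg using Submodule.span_induction generalizing φ with
  | mem g hg => exact (hg.comp φ).mem_degreeLE
  | zero => simpa using const_mem_degreeLE k (0 : S)
  | add g h _ _ hg hh => simpa only [Pi.add_apply, map_add] using! add_mem (hg φ) (hh φ)
  | smul c _ _ hg => exact hg (φ.comp (AddMonoidHom.mulLeft c))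

end

variable [Fintype ι]

/-- The Hamming weight of a sequence of bits, whose parity is the function that is hard to
compute with few queries. -/
def weight (b : ι → Bool) : ℕ := ∑ i, (b i).toNat

lemma neg_one_pow_weight_update_not [DecidableEq ι] {R : Type*} [CommRing R] (b : ι → Bool)
    (i : ι) :
    (-1 : R) ^ weight (Function.update b i (!b i)) = -(-1) ^ weight b := by
  have hrest : ∏ j ∈ Finset.univ.erase i, (-1 : R) ^ (Function.update b i (!b i) j).toNat =
      ∏ j ∈ Finset.univ.erase i, (-1) ^ (b j).toNat :=
    Finset.prod_congr rfl fun j hj => by rw [Function.update_of_ne (Finset.ne_of_mem_erase hj)]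
  simp only [weight, ← Finset.prod_pow_eq_pow_sum]
  rw [← Finset.mul_prod_erase _ _ (Finset.mem_univ i), hrest,
    ← Finset.mul_prod_erase _ (fun j => (-1 : R) ^ (b j).toNat) (Finset.mem_univ i)]
  cases b i <;> simp

lemma sum_neg_one_pow_weight_mul_eq_zero [DecidableEq ι] {R : Type*} [CommRing R] {k : ℕ}
    (hk : k < Fintype.card ι) {g : (ι → Bool) → R} (hg : g ∈ degreeLE R ι k) :
    ∑ b, (-1) ^ weight b * g b = 0 := by
  induction hg using Submodule.span_induction with
  | zero => simp
  | add g h _ _ hg hh => simp [mul_add, Finset.sum_add_distrib, hg, hh]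
  | smul c g _ hg =>
    simp only [Pi.smul_apply, smul_eq_mul, mul_left_comm _ c, ← Finset.mul_sum, hg, mul_zero]
  | mem g hg =>
    obtain ⟨s, hs, hgs⟩ := hg
    obtain ⟨i, hi⟩ : ∃ i, i ∉ s := by
      by_contra! h
      exact (hs.trans_lt hk).ne (by rw [Finset.eq_univ_iff_forall.2 h, Finset.card_univ])
    -- Flipping a bit on which `g` does not depend pairs off terms of opposite sign.
    refine Finset.sum_involution (fun b _ => Function.update b i (!b i)) (fun b _ => ?_)
      (fun b _ _ h => ?_) (by simp) (by simp)
    · have hgb : g (Function.update b i (!b i)) = g b :=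
        hgs fun j hj => Function.update_of_ne (by rintro rfl; exact hi hj) _ _
      rw [hgb, neg_one_pow_weight_update_not]
      ring
    · simpa using congrFun h i

lemma card_le_of_forall_neg_one_pow_weight_mul_pos {R : Type*} [CommRing R] [PartialOrder R]
    [IsOrderedRing R] {k : ℕ} {g : (ι → Bool) → R} (hg : g ∈ degreeLE R ι k)
    (hpos : ∀ b, 0 < (-1) ^ weight b * g b) : Fintype.card ι ≤ k := by
  classical
  by_contra! hk
  exact (Finset.sum_pos (fun b _ => hpos b) Finset.univ_nonempty).ne'
    (sum_neg_one_pow_weight_mul_eq_zero hk hg)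

end BooleanDegree

section OutcomeDistribution

lemma sum_norm_sq_col_of_mem_unitaryGroup {n 𝕜 : Type*} [Fintype n] [DecidableEq n] [RCLike 𝕜]
    {U : Matrix n n 𝕜} (hU : U ∈ Matrix.unitaryGroup n 𝕜) (j : n) : ∑ i, ‖U i j‖ ^ 2 = 1 := by
  have h := congrFun (congrFun (Matrix.mem_unitaryGroup_iff'.1 hU) j) j
  simp only [Matrix.mul_apply, Matrix.one_apply_eq, Matrix.star_apply, RCLike.star_def,
    RCLike.conj_mul] at h
  exact_mod_cast h

variable {D : Type*}

lemma QuantumQuery.act_injective (Q : QuantumQuery D) (f : D → ℝ) :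
    Function.Injective (Q.act f) := by
  have hfst (s : Q.BasisState) : (Q.act f s).1 = s.1 := by
    unfold QuantumQuery.act
    split <;> rfl
  rintro ⟨i, x, y⟩ ⟨i', x', y'⟩ h
  obtain rfl : i = i' := by simpa only [hfst] using congrArg Prod.fst h
  unfold QuantumQuery.act at h
  cases hn : Q.node i with
  | none => simpa [hn] using h
  | some t => simpa [hn] using h

lemma QuantumQuery.matrix_mem_unitaryGroup (Q : QuantumQuery D) (f : D → ℝ) :
    Q.matrix f ∈ Matrix.unitaryGroup Q.BasisState ℂ := by
  rw [Matrix.mem_unitaryGroup_iff']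
  ext s t
  simp [Matrix.mul_apply, Matrix.star_apply, QuantumQuery.matrix, Matrix.one_apply,
    (Q.act_injective f).eq_iff, eq_comm]

lemma UnitaryStage.evolve_mem_unitaryGroup (A : UnitaryStage D) (f : D → ℝ) (j : ℕ) :
    A.evolve f j ∈ Matrix.unitaryGroup A.Q.BasisState ℂ := by
  induction j with
  | zero => exact (A.U 0).2
  | succ j ih => exact mul_mem (mul_mem (A.U (j + 1)).2 (A.Q.matrix_mem_unitaryGroup f)) ih

lemma UnitaryStage.sum_prob (A : UnitaryStage D) (f : D → ℝ) (inp : A.Q.BasisState) :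
    ∑ out, A.prob f inp out = 1 :=
  sum_norm_sq_col_of_mem_unitaryGroup (A.evolve_mem_unitaryGroup f A.n) inp

lemma sum_prod_conditional_eq_one {R : Type*} [CommSemiring R] (n : ℕ) (β : Fin n → Type*)
    [∀ l, Fintype (β l)] (p : (l : Fin n) → ((j : Fin n) → j < l → β j) → β l → R)
    (hp : ∀ l h, ∑ x, p l h x = 1) :
    ∑ ξ : (l : Fin n) → β l, ∏ l, p l (fun j _ => ξ j) (ξ l) = 1 := by
  induction n with
  | zero => simp
  | succ n ih =>
    rw [← (Fin.consEquiv β).sum_comp, Fintype.sum_prod_type]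
    rw [← hp 0 fun j hj => absurd hj (Fin.not_lt_zero j)]
    refine Finset.sum_congr rfl fun x _ => ?_
    let past (l : Fin n) (h : (j : Fin n) → j < l → β j.succ) (j : Fin (n + 1)) :
        j < l.succ → β j :=
      Fin.cases (motive := fun j => j < l.succ → β j) (fun _ => x)
        (fun j hj => h j (Fin.succ_lt_succ_iff.1 hj)) j
    have hpast (l : Fin n) (ξ : (l : Fin n) → β l.succ) :
        past l (fun j _ => ξ j) = fun j _ => (Fin.cons x ξ : (l : Fin (n + 1)) → β l) j := by
      funext j hj
      cases j using Fin.cases <;> rfl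
    have htail := ih (fun l => β l.succ) (fun l h y => p l.succ (past l h) y) fun l h => hp _ _
    simp only [hpast] at htail
    have hzero (h h' : (j : Fin (n + 1)) → j < 0 → β j) : h = h' :=
      funext fun j => funext fun hj => absurd hj (Fin.not_lt_zero j)
    simp only [Fin.consEquiv_apply, Fin.prod_univ_succ, Fin.cons_succ, Fin.cons_zero]
    rw [Finset.sum_congr rfl fun ξ _ => by rw [hzero (fun j _ => Fin.cons x ξ j)],
      ← Finset.mul_sum, htail, mul_one]

namespace QuantumAlgorithm

variable (A : QuantumAlgorithm D) (f : D → ℝ)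

lemma outcomeProb_nonneg (ξ : A.Outcome) : 0 ≤ A.outcomeProb f ξ :=
  Finset.prod_nonneg fun _ _ => sq_nonneg _

lemma sum_outcomeProb : ∑ ξ, A.outcomeProb f ξ = 1 :=
  sum_prod_conditional_eq_one A.numStages (fun l => (A.stage l).Q.BasisState)
    (fun l h => (A.stage l).prob f (A.start l h)) fun l _ => (A.stage l).sum_prob f _

lemma outputProb_eq_sum_indicator (S : Set ℝ) :
    A.outputProb f S = ∑ ξ, (A.output ⁻¹' S).indicator (A.outcomeProb f) ξ := by
  classical
  simp only [outputProb, Set.indicator_apply, Set.mem_preimage]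

lemma outputProb_mono {S T : Set ℝ} (h : S ⊆ T) : A.outputProb f S ≤ A.outputProb f T := by
  simp only [outputProb_eq_sum_indicator]
  exact Finset.sum_le_sum fun ξ _ => Set.indicator_le_indicator_of_subset
    (Set.preimage_mono h) (A.outcomeProb_nonneg f) ξ

lemma outputProb_add_le_one {S T : Set ℝ} (h : Disjoint S T) :
    A.outputProb f S + A.outputProb f T ≤ 1 := by
  simp only [outputProb_eq_sum_indicator]
  rw [← A.sum_outcomeProb f, ← Finset.sum_add_distrib]
  exact Finset.sum_le_sum fun ξ _ =>
    (congrFun (Set.indicator_union_of_disjoint (h.preimage A.output) (A.outcomeProb f)) ξ).ge.trans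
      (Set.indicator_le_self' (fun _ _ => A.outcomeProb_nonneg f _) ξ)

end QuantumAlgorithm

end OutcomeDistribution

section PolynomialMethod

variable {D ι : Type*} {f : (ι → Bool) → D → ℝ} {k : ℕ}

lemma QuantumQuery.isJunta_matrix (hf : ∀ t, IsJunta k fun b => f b t) (Q : QuantumQuery D)
    (s t : Q.BasisState) : IsJunta k fun b => Q.matrix (f b) s t := by
  cases hn : Q.node t.1 with
  | none =>
    simp only [QuantumQuery.matrix, QuantumQuery.act, hn, Matrix.of_apply]
    exact isJunta_const k _
  | some u =>
    simp only [QuantumQuery.matrix, QuantumQuery.act, hn, Matrix.of_apply]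
    exact (hf u).comp fun y => if s = (t.1, t.2.1 + Q.code y, t.2.2) then (1 : ℂ) else 0

namespace UnitaryStage

variable (A : UnitaryStage D)

lemma evolve_mem_degreeLE (hf : ∀ t, IsJunta k fun b => f b t) (j : ℕ) (s t : A.Q.BasisState) :
    (fun b => A.evolve (f b) j s t) ∈ degreeLE ℂ ι (j * k) := by
  induction j generalizing s t with
  | zero => exact const_mem_degreeLE _ _
  | succ j ih =>
    have hevolve : (fun b => A.evolve (f b) (j + 1) s t) =
        ∑ u, (∑ v, (A.U (j + 1) : Matrix A.Q.BasisState A.Q.BasisState ℂ) s v •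
          fun b => A.Q.matrix (f b) v u) * fun b => A.evolve (f b) j u t := by
      funext b
      simp [evolve, Matrix.mul_apply]
    rw [hevolve, Nat.succ_mul, add_comm]
    exact sum_mem fun u _ => mul_mem_degreeLE (sum_mem fun v _ => Submodule.smul_mem _ _
      (A.Q.isJunta_matrix hf v u).mem_degreeLE) (ih u t)

lemma prob_mem_degreeLE (hf : ∀ t, IsJunta k fun b => f b t) (s t : A.Q.BasisState) :
    (fun b => A.prob (f b) s t) ∈ degreeLE ℝ ι (2 * (A.n * k)) := by
  have hprob : (fun b => A.prob (f b) s t) =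
      ((fun b => (A.evolve (f b) A.n t s).re) * fun b => (A.evolve (f b) A.n t s).re) +
        (fun b => (A.evolve (f b) A.n t s).im) * fun b => (A.evolve (f b) A.n t s).im := by
    funext b
    simp [prob, Complex.sq_norm, Complex.normSq_apply]
  have hevolve := A.evolve_mem_degreeLE hf A.n t s
  have hre := comp_mem_degreeLE hevolve Complex.reAddGroupHom
  have him := comp_mem_degreeLE hevolve Complex.imAddGroupHom
  rw [hprob, two_mul]
  exact add_mem (mul_mem_degreeLE hre hre) (mul_mem_degreeLE him him)

end UnitaryStage

namespace QuantumAlgorithm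

lemma outputProb_mem_degreeLE (A : QuantumAlgorithm D) (hf : ∀ t, IsJunta k fun b => f b t)
    (S : Set ℝ) : (fun b => A.outputProb (f b) S) ∈ degreeLE ℝ ι (2 * (A.queries * k)) := by
  classical
  have hsum : (fun b => A.outputProb (f b) S) = ∑ ξ : A.Outcome with A.output ξ ∈ S,
      ∏ l, fun b => (A.stage l).prob (f b) (A.start l fun j _ => ξ j) (ξ l) := by
    funext b
    simp [outputProb, outcomeProb, Finset.sum_filter, Finset.sum_apply, Finset.prod_apply]
  rw [hsum, queries, Finset.sum_mul, Finset.mul_sum]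
  exact sum_mem fun ξ _ => prod_mem_degreeLE _ _ _ fun l _ => (A.stage l).prob_mem_degreeLE hf _ _

end QuantumAlgorithm

lemma eq_of_abs_mul_sub_le {w ε a : ℝ} (hε : 2 * ε < w) {m n : ℕ} (hm : |w * m - a| ≤ ε)
    (hn : |w * n - a| ≤ ε) : m = n := by
  have hw : 0 < w := by linarith [(abs_nonneg _).trans hm]
  have hlt : w * |(m : ℝ) - n| < w * 1 := by
    calc w * |(m : ℝ) - n| = |(w * m - a) - (w * n - a)| := by
          rw [← abs_of_pos hw, ← abs_mul, abs_of_pos hw]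
          ring_nf
      _ ≤ |w * m - a| + |w * n - a| := abs_sub _ _
      _ < w * 1 := by linarith
  have habs : |(m : ℤ) - n| < 1 := by exact_mod_cast lt_of_mul_lt_mul_left hlt hw.le
  have := Int.abs_lt_one_iff.1 habs
  omega

namespace QuantumAlgorithm

theorem Approximates.card_le_of_eq_mul_weight [Fintype ι] (hf : ∀ t, IsJunta k fun b => f b t)
    {I : (D → ℝ) → ℝ} {F : Set (D → ℝ)} (hF : ∀ b, f b ∈ F) {w ε : ℝ}
    (hI : ∀ b, I (f b) = w * weight b) (hε : 2 * ε < w)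
    {A : QuantumAlgorithm D} (hA : A.Approximates I F ε) :
    Fintype.card ι ≤ 2 * (A.queries * k) := by
  classical
  let nearEven : Set ℝ := {a | ∃ m : ℕ, Even m ∧ |w * m - a| ≤ ε}
  refine card_le_of_forall_neg_one_pow_weight_mul_pos
    (sub_mem (A.outputProb_mem_degreeLE hf nearEven) (const_mem_degreeLE _ (1 / 2 : ℝ)))
    fun b => ?_
  have hprob := hA (f b) (hF b)
  rw [hI] at hprob
  rw [Pi.sub_apply]
  rcases Nat.even_or_odd (weight b) with hb | hb
  · have hle : A.outputProb (f b) {a | |w * weight b - a| ≤ ε} ≤ A.outputProb (f b) nearEven :=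
      A.outputProb_mono (f b) fun a ha => ⟨weight b, hb, ha⟩
    rw [hb.neg_one_pow]
    linarith
  · have hdisj : Disjoint nearEven {a | |w * weight b - a| ≤ ε} := by
      rw [Set.disjoint_left]
      rintro a ⟨m, hm, hma⟩ ha
      exact Nat.not_even_iff_odd.2 hb (eq_of_abs_mul_sub_le hε hma ha ▸ hm)
    have hle := A.outputProb_add_le_one (f b) hdisj
    rw [hb.neg_one_pow]
    linarith

/-- With disjoint supports each value of `∑ j, c j * g j` depends on a single coefficient. Scaling
the `g j` to a common integral makes the integral of the sum count the bits. -/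
theorem Approximates.card_le_of_disjoint_support [Fintype ι] [MeasurableSpace D] {μ : Measure D}
    {F : Set (D → ℝ)} {g : ι → D → ℝ} (hint : ∀ j, Integrable (g j) μ)
    (hdisj : Pairwise (Function.onFun Disjoint fun j => Function.support (g j)))
    (hF : ∀ c : ι → ℝ, (∀ j, |c j| ≤ 1) → (fun x => ∑ j, c j * g j x) ∈ F) {v ε : ℝ}
    (hv : 0 < v) (hvg : ∀ j, v ≤ ∫ x, g j x ∂μ) (hε : 2 * ε < v) {A : QuantumAlgorithm D}
    (hA : A.Approximates (fun f => ∫ x, f x ∂μ) F ε) :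
    Fintype.card ι ≤ 2 * A.queries := by
  let coeff (b : ι → Bool) (j : ι) : ℝ := (b j).toNat * (v / ∫ x, g j x ∂μ)
  have hcoeff (b : ι → Bool) (j : ι) : |coeff b j| ≤ 1 := by
    have h0 : 0 ≤ v / ∫ x, g j x ∂μ := div_nonneg hv.le (hv.le.trans (hvg j))
    have h1 : v / ∫ x, g j x ∂μ ≤ 1 := (div_le_one (hv.trans_le (hvg j))).2 (hvg j)
    cases hb : b j <;> simp [coeff, hb, abs_of_nonneg h0, h1]
  have hjunta (x : D) : IsJunta 1 fun b => ∑ j, coeff b j * g j x := by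
    classical
    refine ⟨Finset.univ.filter fun j => g j x ≠ 0, Finset.card_le_one.2 fun i hi j hj => ?_,
      fun b b' hbb' => Finset.sum_congr rfl fun j _ => ?_⟩
    · by_contra hij
      simp only [Finset.mem_filter, Finset.mem_univ, true_and] at hi hj
      exact Set.disjoint_left.1 (hdisj hij) hi hj
    · by_cases hj : g j x = 0
      · simp [hj]
      · simp only [coeff, hbb' j (by simp [hj])]
  have hI (b : ι → Bool) : ∫ x, ∑ j, coeff b j * g j x ∂μ = v * weight b := by
    rw [integral_finsetSum _ fun j _ => (hint j).const_mul _, weight, Nat.cast_sum, Finset.mul_sum]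
    refine Finset.sum_congr rfl fun j _ => ?_
    have := (hv.trans_le (hvg j)).ne'
    rw [integral_const_mul]
    simp only [coeff]
    field_simp
  simpa using hA.card_le_of_eq_mul_weight hjunta (fun b => hF _ (hcoeff b)) hI hε

end QuantumAlgorithm

end PolynomialMethod

section DerivativeBounds

variable {𝕜 E V κ : Type*} [NontriviallyNormedField 𝕜] [NormedAddCommGroup E] [NormedSpace 𝕜 E]
  [NormedAddCommGroup V] [NormedSpace 𝕜 V]

lemma norm_sum_le_of_subsingleton_support [Fintype κ] {w : κ → V}
    (hw : (Function.support w).Subsingleton) {M : ℝ} (hM0 : 0 ≤ M) (hM : ∀ j, ‖w j‖ ≤ M) :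
    ‖∑ j, w j‖ ≤ M := by
  rcases hw.eq_empty_or_singleton with h | ⟨j, h⟩
  · simpa [Function.support_eq_empty_iff.1 h] using hM0
  · rw [Fintype.sum_eq_single j fun k hk => by
      simpa [← Function.notMem_support, h] using hk]
    exact hM j

lemma norm_iteratedFDeriv_sum_le_of_disjoint_tsupport [Fintype κ] {i : ℕ} {ψ : κ → E → V}
    (hψ : ∀ j, ContDiff 𝕜 i (ψ j))
    (hdisj : Pairwise (Function.onFun Disjoint fun j => tsupport (ψ j))) {M : ℝ} (hM0 : 0 ≤ M)
    (hM : ∀ j y, ‖iteratedFDeriv 𝕜 i (ψ j) y‖ ≤ M) (y : E) :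
    ‖iteratedFDeriv 𝕜 i (fun y => ∑ j, ψ j y) y‖ ≤ M := by
  rw [iteratedFDeriv_fun_sum_apply fun j _ => (hψ j).contDiffAt]
  refine norm_sum_le_of_subsingleton_support (fun j hj k hk => ?_) hM0 fun j => hM j y
  by_contra hjk
  exact Set.disjoint_left.1 (hdisj hjk) (support_iteratedFDeriv_subset i hj)
    (support_iteratedFDeriv_subset i hk)

lemma exists_forall_norm_iteratedFDeriv_le {φ : E → V} {r : ℕ} (hφ : ContDiff 𝕜 r φ)
    (hsupp : HasCompactSupport φ) :
    ∃ M, 0 ≤ M ∧ ∀ i ≤ r, ∀ y, ‖iteratedFDeriv 𝕜 i φ y‖ ≤ M := by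
  have hbound (i : ℕ) (hi : i ≤ r) : ∃ C, ∀ y, ‖iteratedFDeriv 𝕜 i φ y‖ ≤ C :=
    (hφ.continuous_iteratedFDeriv (by exact_mod_cast hi)).bounded_above_of_compact_support
      (hsupp.iteratedFDeriv i)
  choose! C hC using hbound
  obtain ⟨M, hM⟩ := ((Finset.Iic r).image C).exists_le
  have hCM (i : ℕ) (hi : i ≤ r) : C i ≤ M :=
    hM _ (Finset.mem_image_of_mem C (Finset.mem_Iic.2 hi))
  exact ⟨M, (norm_nonneg _).trans ((hC 0 r.zero_le 0).trans (hCM 0 r.zero_le)),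
    fun i hi y => (hC i hi y).trans (hCM i hi)⟩

lemma norm_compContinuousLinearMap_const_le {F : Type*} [NormedAddCommGroup F] [NormedSpace 𝕜 F]
    {i : ℕ} (B : ContinuousMultilinearMap 𝕜 (fun _ : Fin i => E) V) (L : F →L[𝕜] E) :
    ‖B.compContinuousLinearMap fun _ => L‖ ≤ ‖B‖ * ‖L‖ ^ i := by
  simpa using B.norm_compContinuousLinearMap_le fun _ => L

lemma norm_iteratedFDeriv_const_mul {i : ℕ} {G : E → 𝕜} {y : E} (hG : ContDiffAt 𝕜 i G y) (c : 𝕜) :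
    ‖iteratedFDeriv 𝕜 i (fun y => c * G y) y‖ = ‖c‖ * ‖iteratedFDeriv 𝕜 i G y‖ := by
  rw [← norm_smul, ← iteratedFDeriv_const_smul_apply hG]
  rfl

end DerivativeBounds

section FunctionClass

lemma norm_iteratedFDeriv_sub_le {E V : Type*} [NormedAddCommGroup E] [NormedSpace ℝ E]
    [NormedAddCommGroup V] [NormedSpace ℝ V] {m : ℕ} {G : E → V} (hG : ContDiff ℝ (m + 1) G)
    {M : ℝ} (hM : ∀ y, ‖iteratedFDeriv ℝ (m + 1) G y‖ ≤ M) (y z : E) :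
    ‖iteratedFDeriv ℝ m G y - iteratedFDeriv ℝ m G z‖ ≤ M * ‖y - z‖ := by
  refine convex_univ.norm_image_sub_le_of_norm_fderiv_le (𝕜 := ℝ) (fun x _ => ?_) (fun x _ => ?_)
    (Set.mem_univ _) (Set.mem_univ _)
  · exact hG.differentiable_iteratedFDeriv (by exact_mod_cast m.lt_succ_self) x
  · rw [norm_fderiv_iteratedFDeriv]
    exact hM x

variable {X E : Type*} [NormedAddCommGroup X] [NormedSpace ℝ X] [NormedAddCommGroup E]
  [NormedSpace ℝ E] {Im : X →L[ℝ] L2I} {r : ℕ} {K : ℕ → ℝ} {M : ℝ}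

lemma comp_mem_classF {L : X →L[ℝ] E} {A : ℝ} (hL : ∀ x, ‖L x‖ ≤ A * ‖Im x‖) (hr : 1 ≤ r)
    {G : E → ℝ} (hG : ContDiff ℝ r G) (hM : ∀ i ≤ r, ∀ y, ‖iteratedFDeriv ℝ i G y‖ ≤ M)
    (hK : ∀ i < r, M * ‖L‖ ^ i ≤ K i) (hKr : M * A * ‖L‖ ^ (r - 1) ≤ K r) :
    (fun x => G (L x)) ∈ classF Im r K := by
  obtain ⟨m, rfl⟩ := Nat.exists_eq_add_of_le' hr
  rw [Nat.add_sub_cancel] at hKr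
  have hM0 : 0 ≤ M := (norm_nonneg _).trans (hM 0 (Nat.zero_le _) 0)
  have hD (i : ℕ) (hi : i ≤ m) (x : X) : iteratedFDeriv ℝ i (fun x => G (L x)) x =
      (iteratedFDeriv ℝ i G (L x)).compContinuousLinearMap fun _ => L :=
    L.iteratedFDeriv_comp_right hG x (by exact_mod_cast hi.trans m.le_succ)
  refine ⟨(hG.of_le (by exact_mod_cast m.le_succ)).comp L.contDiff, fun i hi x => ?_,
    fun x y => ?_⟩
  · rw [hD i (Nat.lt_succ_iff.1 hi)]
    calc _ ≤ ‖iteratedFDeriv ℝ i G (L x)‖ * ‖L‖ ^ i := norm_compContinuousLinearMap_const_le _ _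
      _ ≤ M * ‖L‖ ^ i := by gcongr; exact hM i hi.le _
      _ ≤ K i := hK i hi
  · rw [Nat.add_sub_cancel, hD m le_rfl, hD m le_rfl]
    calc _ = ‖(iteratedFDeriv ℝ m G (L x) - iteratedFDeriv ℝ m G (L y)).compContinuousLinearMap
            fun _ => L‖ := rfl
      _ ≤ ‖iteratedFDeriv ℝ m G (L x) - iteratedFDeriv ℝ m G (L y)‖ * ‖L‖ ^ m :=
          norm_compContinuousLinearMap_const_le _ _
      _ ≤ M * ‖L x - L y‖ * ‖L‖ ^ m := by
          gcongr
          exact norm_iteratedFDeriv_sub_le hG (hM _ le_rfl) _ _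
      _ ≤ M * (A * ‖Im (x - y)‖) * ‖L‖ ^ m := by
          rw [← map_sub]
          gcongr
          exact hL _
      _ = M * A * ‖L‖ ^ m * ‖Im (x - y)‖ := by ring
      _ ≤ K (m + 1) * ‖Im (x - y)‖ := by gcongr

lemma exists_pos_forall_mul_le {R : Type*} [Field R] [LinearOrder R] [IsStrictOrderedRing R]
    {K : ℕ → R} (hK : ∀ i ≤ r, 0 < K i) {B : R} (hB : 0 ≤ B) :
    ∃ a, 0 < a ∧ ∀ i ≤ r, a * B ≤ K i := by
  obtain ⟨i, hi, hmin⟩ := (Finset.Iic r).exists_min_image K ⟨r, by simp⟩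
  have hKi : 0 < K i := hK i (Finset.mem_Iic.1 hi)
  refine ⟨K i / (B + 1), by positivity, fun j hj => ?_⟩
  calc K i / (B + 1) * B = K i * (B / (B + 1)) := by ring
    _ ≤ K i * 1 := by gcongr; exact div_le_one_of_le₀ (by linarith) (by linarith)
    _ ≤ K j := (mul_one _).trans_le (hmin j (Finset.mem_Iic.2 hj))

/-- Rescaling by `n` multiplies the derivatives of order at most `r` by at most `n ^ r`. -/
lemma exists_forall_mul_comp_smul_mem_classF (Im : X →L[ℝ] L2I) (hr : 1 ≤ r)
    (hK : ∀ i ≤ r, 0 < K i) (hM0 : 0 ≤ M) :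
    ∃ a : ℝ, 0 < a ∧ ∀ P : X →L[ℝ] E, (∀ x, ‖P x‖ ≤ ‖Im x‖) → ∀ G : E → ℝ, ContDiff ℝ r G →
      (∀ i ≤ r, ∀ y, ‖iteratedFDeriv ℝ i G y‖ ≤ M) → ∀ n : ℕ, 1 ≤ n →
        (fun x => a / n ^ r * G ((n : ℝ) • P x)) ∈ classF Im r K := by
  have hIm : 1 ≤ 1 + ‖Im‖ := by linarith [norm_nonneg Im]
  obtain ⟨a, ha, haK⟩ := exists_pos_forall_mul_le hK
    (mul_nonneg hM0 (pow_nonneg (zero_le_one.trans hIm) r))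
  refine ⟨a, ha, fun P hP G hG hM n hn => ?_⟩
  have hn1 : (1 : ℝ) ≤ n := by exact_mod_cast hn
  have hPn : ‖P‖ ≤ 1 + ‖Im‖ := P.opNorm_le_bound (by positivity) fun x =>
    (hP x).trans ((Im.le_opNorm x).trans (by gcongr; linarith))
  have hpow (i k : ℕ) (hi : i ≤ r) (hk : k ≤ r) :
      a / n ^ r * M * (n ^ r * ‖P‖ ^ i) ≤ K k := by
    calc a / n ^ r * M * (n ^ r * ‖P‖ ^ i) = a * (M * ‖P‖ ^ i) := by field_simp
      _ ≤ a * (M * (1 + ‖Im‖) ^ r) := by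
          gcongr
          exact (pow_le_pow_left₀ (norm_nonneg _) hPn i).trans (pow_le_pow_right₀ hIm hi)
      _ ≤ K k := haK k hk
  have hnP : ‖(n : ℝ) • P‖ = n * ‖P‖ := by rw [norm_smul, Real.norm_natCast]
  refine comp_mem_classF (L := (n : ℝ) • P) (A := n) (G := fun y => a / n ^ r * G y)
    (M := a / n ^ r * M) (fun x => ?_) hr (contDiff_const.mul hG) (fun i hi y => ?_)
    (fun i hi => ?_) ?_
  · rw [smul_apply, norm_smul, Real.norm_natCast]
    gcongr
    exact hP x
  · rw [norm_iteratedFDeriv_const_mul (hG.of_le (by exact_mod_cast hi)).contDiffAt,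
      Real.norm_of_nonneg (by positivity)]
    gcongr
    exact hM i hi y
  · refine le_trans ?_ (hpow i i hi.le hi.le)
    rw [hnP, mul_pow]
    gcongr
  · refine le_trans (le_of_eq ?_) (hpow (r - 1) r (r.sub_le 1) le_rfl)
    rw [hnP, mul_pow, ← mul_pow_sub_one (Nat.one_le_iff_ne_zero.1 hr) (n : ℝ)]
    ring

end FunctionClass

section LatticeBumps

variable {ι : Type*} {n : ℕ}

/-- The point of the integer lattice with the coordinates `j`. -/
def latticePoint (j : ι → Fin n) : ι → ℝ := fun i => ((j i : ℕ) : ℝ)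

variable [Fintype ι]

lemma one_le_dist_latticePoint {j k : ι → Fin n} (h : j ≠ k) :
    1 ≤ dist (latticePoint j) (latticePoint k) := by
  obtain ⟨i, hi⟩ := Function.ne_iff.1 h
  calc 1 ≤ dist ((j i : ℕ) : ℝ) (k i : ℕ) := by
        rw [Nat.dist_cast_real]
        exact Nat.pairwise_one_le_dist fun h => hi (Fin.ext h)
    _ ≤ dist (latticePoint j) (latticePoint k) :=
        dist_le_pi_dist (latticePoint j) (latticePoint k) i

lemma norm_latticePoint_le (j : ι → Fin n) : ‖latticePoint j‖ ≤ n :=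
  (pi_norm_le_iff_of_nonneg n.cast_nonneg).2 fun i => by
    rw [latticePoint, Real.norm_natCast]
    exact_mod_cast (j i).2.le

/-- A smooth bump function on `ℝ ^ ι`, equal to `1` on the cube of side `1 / 3` around the origin
and supported in the cube of side `2 / 3`. -/
noncomputable def bump (ι : Type*) [Fintype ι] : ContDiffBump (0 : ι → ℝ) :=
  ⟨1 / 6, 1 / 3, by norm_num, by norm_num⟩

/-- The translate of `bump ι` to the lattice point `j`. -/
noncomputable def latticeBump (j : ι → Fin n) (y : ι → ℝ) : ℝ := bump ι (y - latticePoint j)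

lemma contDiff_latticeBump (j : ι → Fin n) (m : ℕ) : ContDiff ℝ m (latticeBump j) :=
  (bump ι).contDiff.comp (contDiff_id.sub contDiff_const)

lemma tsupport_latticeBump (j : ι → Fin n) :
    tsupport (latticeBump j) = Metric.closedBall (latticePoint j) (1 / 3) := by
  have hsupp : Function.support (latticeBump j) = Metric.ball (latticePoint j) (1 / 3) := by
    ext y
    change y - latticePoint j ∈ Function.support (bump ι) ↔ _
    rw [(bump ι).support_eq, mem_ball_zero_iff, mem_ball_iff_norm]
    rfl
  rw [tsupport, hsupp, closure_ball _ (by norm_num)]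

lemma pairwise_disjoint_tsupport_latticeBump :
    Pairwise (Function.onFun Disjoint fun j : ι → Fin n => tsupport (latticeBump j)) :=
  fun j k hjk => by
    simp only [Function.onFun, tsupport_latticeBump]
    exact Metric.closedBall_disjoint_closedBall (by linarith [one_le_dist_latticePoint hjk])

lemma exists_forall_norm_iteratedFDeriv_sum_latticeBump_le (ι : Type*) [Fintype ι] [DecidableEq ι]
    (r : ℕ) :
    ∃ M, 0 ≤ M ∧ ∀ (n : ℕ) (c : (ι → Fin n) → ℝ), (∀ j, |c j| ≤ 1) → ∀ i ≤ r, ∀ y,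
      ‖iteratedFDeriv ℝ i (fun y => ∑ j, c j * latticeBump j y) y‖ ≤ M := by
  obtain ⟨M, hM0, hM⟩ := exists_forall_norm_iteratedFDeriv_le (𝕜 := ℝ) ((bump ι).contDiff (n := r))
    (bump ι).hasCompactSupport
  refine ⟨M, hM0, fun n c hc i hi => norm_iteratedFDeriv_sum_le_of_disjoint_tsupport
    (fun j => contDiff_const.mul (contDiff_latticeBump j i)) (fun j k hjk => ?_) hM0
    fun j y => ?_⟩
  · exact (pairwise_disjoint_tsupport_latticeBump hjk).mono
      (closure_mono (Function.support_mul_subset_right _ _))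
      (closure_mono (Function.support_mul_subset_right _ _))
  · calc ‖iteratedFDeriv ℝ i (fun y => c j * latticeBump j y) y‖
        = |c j| * ‖iteratedFDeriv ℝ i (bump ι) (y - latticePoint j)‖ := by
          rw [norm_iteratedFDeriv_const_mul (contDiff_latticeBump j i).contDiffAt,
            ← iteratedFDeriv_comp_sub]
          rfl
      _ ≤ 1 * M := by gcongr; exacts [hc j, hM i hi _]
      _ = M := one_mul M

lemma exists_forall_sum_latticeBump_mem_classF (ι : Type*) [Fintype ι] [DecidableEq ι]
    {X : Type*} [NormedAddCommGroup X] [NormedSpace ℝ X] {r : ℕ} {K : ℕ → ℝ} (Im : X →L[ℝ] L2I)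
    (hr : 1 ≤ r) (hK : ∀ i ≤ r, 0 < K i) :
    ∃ a : ℝ, 0 < a ∧ ∀ P : X →L[ℝ] (ι → ℝ), (∀ x, ‖P x‖ ≤ ‖Im x‖) → ∀ n : ℕ, 1 ≤ n →
      ∀ b : (ι → Fin n) → ℝ, (∀ j, |b j| ≤ 1) →
        (fun x => ∑ j, b j * (a / n ^ r * latticeBump j ((n : ℝ) • P x))) ∈ classF Im r K := by
  obtain ⟨M, hM0, hM⟩ := exists_forall_norm_iteratedFDeriv_sum_latticeBump_le ι r
  obtain ⟨a, ha, hF⟩ := exists_forall_mul_comp_smul_mem_classF (E := ι → ℝ) Im hr hK hM0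
  refine ⟨a, ha, fun P hP n hn b hb => ?_⟩
  simp only [mul_left_comm (b _), ← Finset.mul_sum]
  exact hF P hP (fun y => ∑ j, b j * latticeBump j y)
    (ContDiff.sum fun j _ => contDiff_const.mul (contDiff_latticeBump j r)) (hM n b hb) n hn

lemma indicator_closedBall_le_latticeBump (j : ι → Fin n) (y : ι → ℝ) :
    (Metric.closedBall (latticePoint j) (1 / 6)).indicator 1 y ≤ latticeBump j y := by
  refine Set.indicator_le' (f := 1) (g := latticeBump j) (fun y hy => ?_)
    (fun y _ => (bump ι).nonneg) y
  exact ((bump ι).one_of_mem_closedBall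
    (mem_closedBall_zero_iff.2 (mem_closedBall_iff_norm.1 hy))).ge

end LatticeBumps

section GaussianMeasures

open NNReal

lemma gaussianPDFReal_le_of_abs_le (m : ℝ) (v : ℝ≥0) {x y : ℝ} (h : |x - m| ≤ |y - m|) :
    gaussianPDFReal m v y ≤ gaussianPDFReal m v x := by
  simp only [gaussianPDFReal]
  gcongr (√(2 * Real.pi * v))⁻¹ * Real.exp (-?_ / (2 * v))
  exact sq_le_sq.2 h

lemma exists_mul_le_gaussianReal_closedBall (m : ℝ) {v : ℝ≥0} (hv : v ≠ 0) (R : ℝ) :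
    ∃ κ : ℝ, 0 < κ ∧ ∀ y ρ, 0 ≤ ρ → dist y m + ρ ≤ R →
      κ * ρ ≤ (gaussianReal m v).real (Metric.closedBall y ρ) := by
  have hpos := gaussianPDFReal_pos m v (m + R) hv
  refine ⟨gaussianPDFReal m v (m + R) * 2, by positivity, fun y ρ hρ hR => ?_⟩
  have hpdf (x : ℝ) (hx : x ∈ Metric.closedBall y ρ) :
      gaussianPDFReal m v (m + R) ≤ gaussianPDFReal m v x := by
    refine gaussianPDFReal_le_of_abs_le m v ?_
    calc |x - m| ≤ dist x y + dist y m := dist_triangle x y m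
      _ ≤ R := by linarith [Metric.mem_closedBall.1 hx]
      _ ≤ |m + R - m| := by simpa using le_abs_self R
  have hint := setIntegral_ge_of_const_le_real measurableSet_closedBall
    measure_closedBall_lt_top.ne hpdf (integrable_gaussianPDFReal m v).integrableOn
  rw [Real.volume_real_closedBall hρ, ← mul_assoc] at hint
  rwa [measureReal_def, gaussianReal_apply_eq_integral m hv,
    ENNReal.toReal_ofReal (integral_nonneg fun x => gaussianPDFReal_nonneg m v x)]

lemma exists_mul_pow_le_pi_gaussianReal_closedBall {ι : Type*} [Fintype ι] (m : ι → ℝ)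
    {v : ι → ℝ≥0} (hv : ∀ i, v i ≠ 0) (R : ℝ) :
    ∃ c : ℝ, 0 < c ∧ ∀ y ρ, 0 ≤ ρ → dist y m + ρ ≤ R →
      c * ρ ^ Fintype.card ι ≤
        (Measure.pi fun i => gaussianReal (m i) (v i)).real (Metric.closedBall y ρ) := by
  choose κ hκ0 hκ using fun i => exists_mul_le_gaussianReal_closedBall (m i) (hv i) R
  refine ⟨∏ i, κ i, Finset.prod_pos fun i _ => hκ0 i, fun y ρ hρ hR => ?_⟩
  rw [measureReal_def, Measure.pi_closedBall _ y hρ, ENNReal.toReal_prod, ← Finset.card_univ,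
    Finset.prod_mul_pow_card]
  exact Finset.prod_le_prod (fun i _ => mul_nonneg (hκ0 i).le hρ) fun i _ =>
    hκ i (y i) ρ hρ ((add_le_add_left (dist_le_pi_dist y m i) ρ).trans hR)

variable {ι H : Type*} [NormedAddCommGroup H] [InnerProductSpace ℝ H] {η : ι → H}

/-- The coordinates of a vector with respect to a family `η`, which are the coefficients of its
orthogonal projection to the span of `η` when `η` is orthonormal. -/
noncomputable def innerPi (η : ι → H) : H →L[ℝ] (ι → ℝ) :=
  ContinuousLinearMap.pi fun i => innerSL ℝ (η i)

lemma norm_innerPi_le [Fintype ι] (hη : ∀ i, ‖η i‖ = 1) (h : H) : ‖innerPi η h‖ ≤ ‖h‖ :=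
  (pi_norm_le_iff_of_nonneg (norm_nonneg h)).2 fun i => by
    simpa [innerPi, hη i] using norm_inner_le_norm (𝕜 := ℝ) (η i) h

variable [CompleteSpace H] [MeasurableSpace H] [BorelSpace H] {ν : Measure H}
  {eig : ι → ℝ}

lemma covariance_innerSL_of_covarianceOperator_apply [DecidableEq ι] (hmem : MemLp id 2 ν)
    (hν : ∀ L : StrongDual ℝ H, ∫ h, L h ∂ν = 0) (hη : Orthonormal ℝ η)
    (hC : ∀ i, covarianceOperator ν (η i) = eig i • η i) (i j : ι) :
    cov[innerSL ℝ (η i), innerSL ℝ (η j); ν] = if i = j then eig i else 0 := by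
  calc cov[innerSL ℝ (η i), innerSL ℝ (η j); ν]
      = ∫ h, inner ℝ (η i) h * inner ℝ (η j) h ∂ν := by
        rw [covariance, hν, hν]
        simp only [sub_zero, innerSL_apply_apply]
    _ = inner ℝ (covarianceOperator ν (η i)) (η j) := (covarianceOperator_inner hmem _ _).symm
    _ = if i = j then eig i else 0 := by
        rw [hC, real_inner_smul_left, orthonormal_iff_ite.1 hη, mul_ite, mul_one, mul_zero]

lemma map_innerPi_eq_pi_gaussianReal [Fintype ι] [SecondCountableTopology H] [IsGaussian ν]
    (hν : ∀ L : StrongDual ℝ H, ∫ h, L h ∂ν = 0) (hη : Orthonormal ℝ η)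
    (hC : ∀ i, covarianceOperator ν (η i) = eig i • η i) :
    ν.map (innerPi η) = Measure.pi fun i => gaussianReal 0 (eig i).toNNReal := by
  classical
  have hcov := covariance_innerSL_of_covarianceOperator_apply IsGaussian.memLp_two_id hν hη hC
  have hlaw : HasGaussianLaw (fun h i => innerSL ℝ (η i) h) ν :=
    ⟨inferInstanceAs (IsGaussian (ν.map (innerPi η)))⟩
  have hind : iIndepFun (fun i h => innerSL ℝ (η i) h) ν :=
    hlaw.iIndepFun_of_covariance_eq_zero fun i j hij => (hcov i j).trans (if_neg hij)
  have hmap (i : ι) : ν.map (innerSL ℝ (η i)) = gaussianReal 0 (eig i).toNNReal := by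
    rw [IsGaussian.map_eq_gaussianReal, hν, ← covariance_self (by fun_prop), hcov, if_pos rfl]
  rw [← funext hmap]
  exact (iIndepFun_iff_map_fun_eq_pi_map fun i => by fun_prop).1 hind

end GaussianMeasures

section QueryLowerBound

variable {ι : Type*} [Fintype ι]

lemma integrable_latticeBump_comp {Ω : Type*} [MeasurableSpace Ω] {μ : Measure Ω}
    [IsFiniteMeasure μ] {n : ℕ} (j : ι → Fin n) {f : Ω → ι → ℝ} (hf : Measurable f) :
    Integrable (fun x => latticeBump j (f x)) μ := by
  refine Integrable.of_bound
    ((contDiff_latticeBump j 0).continuous.measurable.comp hf).aestronglyMeasurable 1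
    (ae_of_all _ fun x => ?_)
  rw [latticeBump, Real.norm_of_nonneg (bump ι).nonneg]
  exact (bump ι).le_one

lemma measureReal_preimage_closedBall_le_integral_latticeBump {Ω : Type*} [MeasurableSpace Ω]
    {μ : Measure Ω} [IsFiniteMeasure μ] {n : ℕ} (j : ι → Fin n) {f : Ω → ι → ℝ}
    (hf : Measurable f) :
    μ.real (f ⁻¹' Metric.closedBall (latticePoint j) (1 / 6)) ≤ ∫ x, latticeBump j (f x) ∂μ := by
  have hmeas := hf (measurableSet_closedBall (x := latticePoint j) (ε := 1 / 6))
  rw [← integral_indicator_one hmeas]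
  exact integral_mono ((integrable_const 1).indicator hmeas) (integrable_latticeBump_comp j hf)
    fun x => indicator_closedBall_le_latticeBump j (f x)

lemma exists_div_pow_le_integral_latticeBump (m : ι → ℝ) {v : ι → NNReal} (hv : ∀ i, v i ≠ 0) :
    ∃ c : ℝ, 0 < c ∧ ∀ n : ℕ, 1 ≤ n → ∀ j : ι → Fin n, c / n ^ Fintype.card ι ≤
      ∫ y, latticeBump j ((n : ℝ) • y) ∂(Measure.pi fun i => gaussianReal (m i) (v i)) := by
  obtain ⟨c, hc, hball⟩ := exists_mul_pow_le_pi_gaussianReal_closedBall m hv (2 + ‖m‖)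
  refine ⟨c / 6 ^ Fintype.card ι, by positivity, fun n hn j => ?_⟩
  have hn1 : (1 : ℝ) ≤ n := by exact_mod_cast hn
  have hn0 : (0 : ℝ) < n := by linarith
  have hcenter : ‖(n : ℝ)⁻¹ • latticePoint j‖ ≤ 1 := by
    rw [norm_smul, norm_inv, Real.norm_natCast, inv_mul_le_one₀ hn0]
    exact norm_latticePoint_le j
  have hradius : (n : ℝ)⁻¹ * (1 / 6) ≤ 1 :=
    mul_le_one₀ (inv_le_one_of_one_le₀ hn1) (by norm_num) (by norm_num)
  have hpreimage : (fun y => (n : ℝ) • y) ⁻¹' Metric.closedBall (latticePoint j) (1 / 6) =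
      Metric.closedBall ((n : ℝ)⁻¹ • latticePoint j) ((n : ℝ)⁻¹ * (1 / 6)) := by
    rw [Set.preimage_smul₀ hn0.ne', smul_closedBall _ _ (by norm_num), norm_inv,
      Real.norm_natCast]
  calc c / 6 ^ Fintype.card ι / n ^ Fintype.card ι
      = c * ((n : ℝ)⁻¹ * (1 / 6)) ^ Fintype.card ι := by
        rw [mul_pow, inv_pow, one_div, inv_pow]
        ring
    _ ≤ (Measure.pi fun i => gaussianReal (m i) (v i)).real
          (Metric.closedBall ((n : ℝ)⁻¹ • latticePoint j) ((n : ℝ)⁻¹ * (1 / 6))) :=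
        hball _ _ (by positivity) (by
          linarith [dist_le_norm_add_norm ((n : ℝ)⁻¹ • latticePoint j) m])
    _ ≤ _ := hpreimage ▸
        measureReal_preimage_closedBall_le_integral_latticeBump j (by fun_prop)

variable {X : Type*} [NormedAddCommGroup X] [NormedSpace ℝ X] [MeasurableSpace X] [BorelSpace X]
  {μ : Measure X} [IsGaussian μ] {Im : X →L[ℝ] L2I} {η : ι → L2I} {eig : ι → ℝ} {r : ℕ}
  {K : ℕ → ℝ}

lemma map_innerPi_comp_eq_pi_gaussianReal (hμ : ∀ L : StrongDual ℝ X, ∫ x, L x ∂μ = 0)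
    (hη : Orthonormal ℝ η) (hC : ∀ i, covarianceOperator (μ.map Im) (η i) = eig i • η i) :
    μ.map ((innerPi η).comp Im) = Measure.pi fun i => gaussianReal 0 (eig i).toNNReal := by
  have : Fact ((2 : ℝ≥0∞) ≠ ∞) := ⟨ENNReal.ofNat_ne_top⟩
  rw [ContinuousLinearMap.coe_comp, ← Measure.map_map (by fun_prop) (by fun_prop)]
  refine map_innerPi_eq_pi_gaussianReal (fun L => ?_) hη hC
  rw [integral_map (by fun_prop) (by fun_prop)]
  exact hμ (L.comp Im)

lemma exists_pow_card_le_two_mul_queries (hμ : ∀ L : StrongDual ℝ X, ∫ x, L x ∂μ = 0)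
    (hη : Orthonormal ℝ η) (hC : ∀ i, covarianceOperator (μ.map Im) (η i) = eig i • η i)
    (heig : ∀ i, 0 < eig i) (hr : 1 ≤ r) (hK : ∀ i ≤ r, 0 < K i) :
    ∃ B : ℝ, 0 < B ∧ ∀ n : ℕ, 1 ≤ n → ∀ ε ≤ B / n ^ (r + Fintype.card ι),
      ∀ A : QuantumAlgorithm X, A.Approximates (pathIntegral μ) (classF Im r K) ε →
        n ^ Fintype.card ι ≤ 2 * A.queries := by
  classical
  obtain ⟨a, ha, hF⟩ := exists_forall_sum_latticeBump_mem_classF ι Im hr hK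
  obtain ⟨c, hc, hint⟩ := exists_div_pow_le_integral_latticeBump (ι := ι) 0
    fun i => (Real.toNNReal_pos.2 (heig i)).ne'
  refine ⟨a * c / 3, by positivity, fun n hn ε hε A hA => ?_⟩
  set P : X →L[ℝ] (ι → ℝ) := (innerPi η).comp Im with hP
  have hn0 : (0 : ℝ) < n := by exact_mod_cast hn
  let g (j : ι → Fin n) (x : X) : ℝ := a / n ^ r * latticeBump j ((n : ℝ) • P x)
  have hgint (j : ι → Fin n) : Integrable (g j) μ :=
    (integrable_latticeBump_comp j (by fun_prop)).const_mul _
  have hgdisj : Pairwise (Function.onFun Disjoint fun j => Function.support (g j)) :=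
    fun j k hjk => ((pairwise_disjoint_tsupport_latticeBump hjk).preimage
      fun x => (n : ℝ) • P x).mono
      (fun x hx => subset_tsupport (latticeBump j) (right_ne_zero_of_mul hx))
      (fun x hx => subset_tsupport (latticeBump k) (right_ne_zero_of_mul hx))
  have hgI (j : ι → Fin n) : a * c / n ^ (r + Fintype.card ι) ≤ ∫ x, g j x ∂μ := by
    calc a * c / n ^ (r + Fintype.card ι) = a / n ^ r * (c / n ^ Fintype.card ι) := by
          rw [pow_add, mul_div_mul_comm]
      _ ≤ a / n ^ r * ∫ y, latticeBump j ((n : ℝ) • y) ∂(μ.map P) := by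
          rw [hP, map_innerPi_comp_eq_pi_gaussianReal hμ hη hC]
          gcongr
          exact hint n hn j
      _ = ∫ x, g j x ∂μ := by
          rw [integral_map (by fun_prop) (integrable_latticeBump_comp j
            (by fun_prop)).aestronglyMeasurable, integral_const_mul]
  have hpos : 0 < a * c / (n : ℝ) ^ (r + Fintype.card ι) := by positivity
  have hε2 : 2 * ε < a * c / n ^ (r + Fintype.card ι) := by
    rw [div_right_comm] at hε
    linarith
  simpa using QuantumAlgorithm.Approximates.card_le_of_disjoint_support hgint hgdisj
    (hF P (fun x => norm_innerPi_le hη.1 (Im x)) n hn) hpos hgI hε2 hA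

lemma exists_nat_le_div_pow {B ε : ℝ} (hε : 0 < ε) (hεB : ε ≤ B) {k : ℕ} (hk : k ≠ 0) :
    ∃ n : ℕ, 1 ≤ n ∧ ε ≤ B / n ^ k ∧ (B / ε) ^ (k : ℝ)⁻¹ / 2 ≤ n := by
  set t : ℝ := (B / ε) ^ (k : ℝ)⁻¹
  have hBε : 1 ≤ B / ε := (one_le_div hε).2 hεB
  have ht1 : 1 ≤ t := Real.one_le_rpow hBε (by positivity)
  have hn1 : 1 ≤ ⌊t⌋₊ := (Nat.one_le_floor_iff t).2 ht1
  refine ⟨⌊t⌋₊, hn1, ?_, (Nat.div_two_lt_floor ht1).le⟩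
  rw [le_div_comm₀ hε (by positivity)]
  calc (⌊t⌋₊ : ℝ) ^ k ≤ t ^ k := by gcongr; exact Nat.floor_le (by positivity)
    _ = B / ε := Real.rpow_inv_natCast_pow (by positivity) hk

lemma exists_ofReal_mul_rpow_le_qq (hμ : ∀ L : StrongDual ℝ X, ∫ x, L x ∂μ = 0)
    (hη : Orthonormal ℝ η) (hC : ∀ i, covarianceOperator (μ.map Im) (η i) = eig i • η i)
    (heig : ∀ i, 0 < eig i) (hr : 1 ≤ r) (hK : ∀ i ≤ r, 0 < K i) :
    ∃ C : ℝ, 0 < C ∧ ∀ᶠ ε in 𝓝[>] 0,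
      ENNReal.ofReal (C * ε ^ (-(Fintype.card ι / (r + Fintype.card ι) : ℝ))) ≤
        (qq (pathIntegral μ) (classF Im r K) ε : ℕ∞) := by
  obtain ⟨B, hB, hBq⟩ := exists_pow_card_le_two_mul_queries hμ hη hC heig hr hK
  set d := Fintype.card ι
  set θ : ℝ := d / (r + d) with hθ
  refine ⟨B ^ θ / 2 ^ d / 2, by positivity, ?_⟩
  filter_upwards [Ioc_mem_nhdsGT hB] with ε ⟨hε0, hεB⟩
  obtain ⟨n, hn, hεn, htn⟩ := exists_nat_le_div_pow hε0 hεB (k := r + d) (by omega)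
  rw [qq]
  simp only [ENat.toENNReal_iInf, ENat.toENNReal_coe]
  refine le_iInf₂ fun A hA => ?_
  rw [← ENNReal.ofReal_natCast]
  refine ENNReal.ofReal_le_ofReal ?_
  have hqueries : (n : ℝ) ^ d ≤ 2 * A.queries := by exact_mod_cast hBq n hn ε hεn A hA
  calc B ^ θ / 2 ^ d / 2 * ε ^ (-θ) = ((B / ε) ^ ((r + d : ℕ) : ℝ)⁻¹ / 2) ^ d / 2 := by
        rw [div_pow, ← Real.rpow_mul_natCast (by positivity), Nat.cast_add, inv_mul_eq_div, ← hθ,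
          Real.div_rpow hB.le hε0.le, Real.rpow_neg hε0.le]
        ring
    _ ≤ n ^ d / 2 := by gcongr
    _ ≤ A.queries := by linarith

end QueryLowerBound

lemma tendsto_ofReal_rpow_mul_nhds_top {q : ℝ → ℝ≥0∞} {C γ θ : ℝ} (hC : 0 < C) (hγθ : γ < θ)
    (hq : ∀ᶠ ε in 𝓝[>] 0, ENNReal.ofReal (C * ε ^ (-θ)) ≤ q ε) :
    Tendsto (fun ε : ℝ => ENNReal.ofReal (ε ^ γ) * q ε) (𝓝[>] 0) (𝓝 ⊤) := by
  have hlim : Tendsto (fun ε : ℝ => ENNReal.ofReal (C * ε ^ (γ - θ))) (𝓝[>] 0) (𝓝 ⊤) :=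
    ENNReal.tendsto_ofReal_atTop.comp
      ((tendsto_rpow_neg_nhdsGT_zero (sub_neg.2 hγθ)).const_mul_atTop hC)
  refine tendsto_nhds_top_mono hlim ?_
  filter_upwards [hq, self_mem_nhdsWithin] with ε hqε (hε : 0 < ε)
  calc ENNReal.ofReal (C * ε ^ (γ - θ))
      = ENNReal.ofReal (ε ^ γ) * ENNReal.ofReal (C * ε ^ (-θ)) := by
        rw [← ENNReal.ofReal_mul (by positivity), sub_eq_add_neg, Real.rpow_add hε]
        congr 1
        ring
    _ ≤ ENNReal.ofReal (ε ^ γ) * q ε := by gcongr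

end PathInt

theorem theorem3_general {X : Type*} [NormedAddCommGroup X] [NormedSpace ℝ X]
    [MeasurableSpace X] [BorelSpace X]
    (μ : Measure X) [IsGaussian μ] (hμ : ∀ L : StrongDual ℝ X, ∫ x, L x ∂μ = 0)
    (Im : X →L[ℝ] PathInt.L2I)
    (η : ℕ → PathInt.L2I) (hη : Orthonormal ℝ η) (eig : ℕ → ℝ)
    (hC : ∀ i, covarianceOperator (μ.map Im) (η i) = eig i • η i)
    (heig : ∀ i, 0 < eig i)
    (r : ℕ) (hr : 1 ≤ r) (K : ℕ → ℝ) (hK : ∀ i ≤ r, 0 < K i)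
    (α : ℝ) (hα : 0 < α) :
    Tendsto
      (fun ε : ℝ => ENNReal.ofReal (ε ^ (1 - α)) *
        ((PathInt.qq (PathInt.pathIntegral μ) (PathInt.classF Im r K) ε : ℕ∞) : ℝ≥0∞))
      (𝓝[>] 0) (𝓝 ⊤) := by
  obtain ⟨d, hd⟩ := exists_nat_gt ((1 - α) * r / α)
  have hexp : 1 - α < Fintype.card (Fin d) / (r + Fintype.card (Fin d)) := by
    rw [div_lt_iff₀ hα] at hd
    rw [Fintype.card_fin, lt_div_iff₀ (by positivity)]
    linarith
  obtain ⟨C, hC0, hqq⟩ := PathInt.exists_ofReal_mul_rpow_le_qq hμ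
    (hη.comp Fin.val Fin.val_injective) (fun i => hC i) (fun i => heig i) hr hK
  exact PathInt.tendsto_ofReal_rpow_mul_nhds_top hC0 hexp hqq

theorem theorem3 {X : Type*} [NormedAddCommGroup X] [NormedSpace ℝ X] [CompleteSpace X]
    [TopologicalSpace.SeparableSpace X] [MeasurableSpace X] [BorelSpace X]
    (μ : Measure X) [IsGaussian μ] (hμ : ∀ L : StrongDual ℝ X, ∫ x, L x ∂μ = 0)
    (Im : X →L[ℝ] PathInt.L2I) (hIm : Function.Injective Im)
    (η : ℕ → PathInt.L2I) (hη : Orthonormal ℝ η) (eig : ℕ → ℝ)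
    (hC : ∀ i, covarianceOperator (μ.map Im) (η i) = eig i • η i)
    (heig : ∀ i, 0 < eig i)
    (r : ℕ) (hr : 1 ≤ r) (K : ℕ → ℝ) (hK : ∀ i ≤ r, 0 < K i)
    (α : ℝ) (hα : α ∈ Set.Ioo (0 : ℝ) 1) :
    Tendsto
      (fun ε : ℝ => ENNReal.ofReal (ε ^ (1 - α)) *
        ((PathInt.qq (PathInt.pathIntegral μ) (PathInt.classF Im r K) ε : ℕ∞) : ℝ≥0∞))
      (𝓝[>] 0) (𝓝 ⊤) :=
  theorem3_general μ hμ Im η hη eig hC heig r hr K hK α hα.1
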